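/- For integers $k\ge 1$, $n\ge 0$ and $y\in\mathbb{Z}_k^n$, let $[y]$ be the number of non-zero coordinates of $y$, let $w_y(x)=e^{2\pi i\langle x,y\rangle/k}$ for $x\in\mathbb{Z}_k^n$, where $\langle x,y\rangle=\sum_i x_iy_i$, and let $\nu^n$ be the uniform probability measure on $\mathbb{Z}_k^n$. For a measure $\eta$ and $q\ge 1$ write $\|f\|_{L^q(\eta)}=\left(\int|f|^q\,d\eta\right)^{1/q}$. Call a pair of positive real numbers $(C,\gamma)$ admissible if for all $k\ge 1$, $n\ge 0$, $m\in\{0,1,\dots,n\}$ and complex numbers $a_y$ $(y\in\mathbb{Z}_k^n)$, $$\Big\|\sum_{[y]=m}a_yw_y\Big\|_{L^4(\nu^n)}\le (Ck^\gamma)^m\Big(\sum_{[y]=m}|a_y|^2\Big)^{1/2}.$$ Let $\mu$ be a probability measure on $\mathbb{Z}_k$ with $\mu(\{j\})>0$ for all $j\in\mathbb{Z}_k$, and let $(c_j)_{j\in\mathbb{Z}_k}$ be an orthonormal basis of the space of functions $\mathbb{Z}_k\to\mathbb{C}$ with the inner product $\langle a,b\rangle_\mu=\int a\,\overline{b}\,d\mu$,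 such that $c_0\equiv 1$. Put $u_y(x)=\prod_{i=1}^n c_{y_i}(x_i)$ for $x,y\in\mathbb{Z}_k^n$ and $\theta=k\max_{i,j\in\mathbb{Z}_k}|c_i(j)|$. For $g:\mathbb{Z}_k^n\to\mathbb{C}$ let $\hat g(y)=\int g\,\overline{u_y}\,d\mu^n$, where $\mu^n$ is the $n$-fold product measure, let $M(g)\ge 0$ be defined by $$M(g)^2=\sum_{y\in\mathbb{Z}_k^n,\;y\ne 0}\frac{|\hat g(y)|^2}{[y]},$$ and write $\|g\|_q=\|g\|_{L^q(\mu^n)}$. Then admissible pairs $(C,\gamma)$ exist, and there is a universal constant $K>0$ such that for every admissible pair $(C,\gamma)$, all $k\ge1$ and $n\ge0$, all $\mu$ and $(c_j)_{j\in\mathbb{Z}_k}$ as above, and every $g:\mathbb{Z}_k^n\to\mathbb{C}$ with $\int g\,d\mu^n=0$, $$M(g)^2\le K\log\left(C\theta k^\gamma\right)\frac{\|g\|_2^2}{\log\left(e\|g\|_2/\|g\|_1\right)},$$ where the right-hand side is read as $0$ if $g=0$. -/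

import Mathlib

open MeasureTheory

noncomputable section

namespace TalagrandZk

/-- The `L^q` norm `(∫ |f|^q dη)^{1/q}` of a complex valued function. -/
def lqNorm {X : Type*} [MeasurableSpace X] (η : Measure X) (q : ℝ) (f : X → ℂ) : ℝ :=
  (∫ x, ‖f x‖ ^ q ∂η) ^ (1 / q)

/-- The inner product `⟨f, g⟩_η = ∫ f \bar g dη`. -/
def ip {X : Type*} [MeasurableSpace X] (η : Measure X) (f g : X → ℂ) : ℂ :=
  ∫ x, f x * (starRingEnd ℂ) (g x) ∂η

/-- The character `w_y(x) = ε^{⟨x, y⟩}` of `ℤ_k^n`, where `ε = e^{2πi/k}` and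
`⟨x, y⟩ = ∑ x_i y_i`. -/
def w {k : ℕ} [NeZero k] {n : ℕ} (y x : Fin n → ZMod k) : ℂ :=
  ZMod.stdAddChar (∑ i, x i * y i)

/-- `C` and `γ` are admissible constants in the hypercontractive inequality for the uniform
measure on `ℤ_k^n`: they are positive, and for all `k ≥ 1`, `n`, `0 ≤ m ≤ n` and complex
coefficients `a_y`, the `L⁴` norm of `∑_{[y] = m} a_y w_y` is at most
`(C k^γ)^m (∑_{[y] = m} |a_y|²)^{1/2}`. -/
def HypercontractiveConstants (C γ : ℝ) : Prop :=
  0 < C ∧ 0 < γ ∧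
    ∀ (k : ℕ) [NeZero k] (n m : ℕ), m ≤ n → ∀ a : (Fin n → ZMod k) → ℂ,
      lqNorm (ProbabilityTheory.uniformOn (Set.univ : Set (Fin n → ZMod k))) 4
          (fun x => ∑ y with hammingNorm y = m, a y * w y x)
        ≤ (C * (k : ℝ) ^ γ) ^ m * √(∑ y with hammingNorm y = m, ‖a y‖ ^ 2)

/-- `c_j`, `j ∈ ℤ_k`, is an orthonormal basis of `L_μ(ℤ_k)` with `c_0` the constant function `1`.
(The `k` orthonormal functions span, since the space of functions on `ℤ_k` has dimension `k`.) -/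
def IsAdaptedBasis {k : ℕ} (μ : Measure (ZMod k)) (c : ZMod k → ZMod k → ℂ) : Prop :=
  (∀ x, c 0 x = 1) ∧ ∀ i j, ip μ (c i) (c j) = if i = j then 1 else 0

/-- The product basis `u_y(x) = ∏_i c_{y_i}(x_i)`. -/
def u {k n : ℕ} (c : ZMod k → ZMod k → ℂ) (y x : Fin n → ZMod k) : ℂ :=
  ∏ i, c (y i) (x i)

/-- The product measure `μ^n` on `ℤ_k^n`. -/
abbrev powMeasure {k : ℕ} (μ : Measure (ZMod k)) (n : ℕ) : Measure (Fin n → ZMod k) :=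
  Measure.pi fun _ => μ

/-- The Fourier coefficient `ĝ(y) = ⟨g, u_y⟩` in `L_{μ^n}(ℤ_k^n)`. -/
def coeff {k n : ℕ} (μ : Measure (ZMod k)) (c : ZMod k → ZMod k → ℂ)
    (g : (Fin n → ZMod k) → ℂ) (y : Fin n → ZMod k) : ℂ :=
  ip (powMeasure μ n) g (u c y)

/-- `M(g) = (∑_{y ≠ 0} |ĝ(y)|² / [y])^{1/2}`, where `[y]` (the Hamming norm) is the number of
non-zero coordinates of `y`. -/
def M {k : ℕ} [NeZero k] {n : ℕ} (μ : Measure (ZMod k)) (c : ZMod k → ZMod k → ℂ)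
    (g : (Fin n → ZMod k) → ℂ) : ℝ :=
  √(∑ y with y ≠ 0, ‖coeff μ c g y‖ ^ 2 / (hammingNorm y : ℝ))

/-- `θ = k max_{i, j ∈ ℤ_k} |c_i(j)|`. -/
def theta {k : ℕ} [NeZero k] (c : ZMod k → ZMod k → ℂ) : ℝ :=
  k * ⨆ p : ZMod k × ZMod k, ‖c p.1 p.2‖

end TalagrandZk

end

namespace TalagrandZk

/-! The bound holds with `log θ` alone. Let `T` multiply the coefficient at `y` by `ρ^[y]`, with `ρ
= θ⁻²`. Each `c_j`, `j ≠ 0`, has mean zero and is at most `θ / k` in modulus, so scaling by `ρ`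
makes it so small that `T` is a contraction from `ℓ²` coefficients to `L⁴`: in one variable by
expanding a fourth power (`hypercontractive_one`), then by induction on `n` with Minkowski's
inequality.

By duality, `∑ ρ^(2[y]) |ĝ(y)|² ≤ ‖g‖₁ ‖g‖₂`. Splitting `M(g)²` at degree `N`, this controls `[y] ≤
N` at cost `θ^(4N)`, while Bessel bounds the rest by `‖g‖₂² / (N + 1)`. Taking `N` of order
`log(‖g‖₂ / ‖g‖₁) / log θ` balances the two.

An admissible pair enters only through `C k^γ ≥ 1` for `k ≥ 2`, which gives `log θ ≤ log(C θ k^γ)`.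
Existence of such a pair follows from the same contraction applied to characters. -/

/-- Cauchy-Schwarz with weights. -/
theorem sq_sum_mul_le {X : Type*} (s : Finset X) (P f g : X → ℝ) (hP : ∀ x ∈ s, 0 ≤ P x) :
    (∑ x ∈ s, P x * (f x * g x)) ^ 2 ≤ (∑ x ∈ s, P x * f x ^ 2) * ∑ x ∈ s, P x * g x ^ 2 := by
  apply Finset.sum_sq_le_sum_mul_sum_of_sq_le_mul
  · intro x hx; exact mul_nonneg (hP x hx) (sq_nonneg _)
  · intro x hx; exact mul_nonneg (hP x hx) (sq_nonneg _)
  · intro x _; exact le_of_eq (by ring)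

/-- Minkowski's inequality in a weighted `ℓ²` space. -/
theorem sum_sq_sum_le {X J : Type*} [Fintype X] [Fintype J] (P : X → ℝ) (hP : ∀ x, 0 ≤ P x)
    (s : J → X → ℝ) (t : J → ℝ) (ht : ∀ j, 0 ≤ t j)
    (h : ∀ j, ∑ x, P x * s j x ^ 2 ≤ t j ^ 2) :
    ∑ x, P x * (∑ j, s j x) ^ 2 ≤ (∑ j, t j) ^ 2 := by
  have key : ∀ i j, ∑ x, P x * (s i x * s j x) ≤ t i * t j := fun i j => by
    refine (abs_le_of_sq_le_sq' ?_ (mul_nonneg (ht i) (ht j))).2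
    refine (sq_sum_mul_le _ P _ _ fun x _ => hP x).trans ?_
    rw [mul_pow]
    exact mul_le_mul (h i) (h j)
      (Finset.sum_nonneg fun x _ => mul_nonneg (hP x) (sq_nonneg _)) (sq_nonneg _)
  calc ∑ x, P x * (∑ j, s j x) ^ 2
      = ∑ i, ∑ j, ∑ x, P x * (s i x * s j x) := by
        simp_rw [sq, Finset.sum_mul_sum, Finset.mul_sum]
        rw [Finset.sum_comm]
        exact Finset.sum_congr rfl fun i _ => Finset.sum_comm
    _ ≤ ∑ i, ∑ j, t i * t j := Finset.sum_le_sum fun i _ => Finset.sum_le_sum fun j _ => key i j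
    _ = (∑ j, t j) ^ 2 := by rw [sq, Finset.sum_mul_sum]

/-! ### Hypercontractivity from `L²` to `L⁴` -/

/-- The term linear in `w` is kept exact because it vanishes on averaging when `w` has mean zero.
The other mixed terms are absorbed by `|Re(z w̄)| ≤ |z||w|` and `2|z||w| ≤ |z|² + |w|²`. -/
theorem norm_add_pow_four_le (z w : ℂ) :
    ‖z + w‖ ^ 4 ≤ ‖z‖ ^ 4 + 4 * ‖z‖ ^ 2 * (z * (starRingEnd ℂ) w).re
      + 8 * ‖z‖ ^ 2 * ‖w‖ ^ 2 + 3 * ‖w‖ ^ 4 := by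
  have h1 : ‖z + w‖ ^ 2 = ‖z‖ ^ 2 + ‖w‖ ^ 2 + 2 * (z * (starRingEnd ℂ) w).re := by
    simp only [← Complex.normSq_eq_norm_sq]; exact Complex.normSq_add z w
  have h2 : |(z * (starRingEnd ℂ) w).re| ≤ ‖z‖ * ‖w‖ := by
    refine (Complex.abs_re_le_norm _).trans ?_
    simp
  set r := (z * (starRingEnd ℂ) w).re
  have h3 : r ^ 2 ≤ (‖z‖ * ‖w‖) ^ 2 := sq_le_sq' (abs_le.1 h2).1 (abs_le.1 h2).2
  have h4 : r * ‖w‖ ^ 2 ≤ ‖z‖ * ‖w‖ * ‖w‖ ^ 2 :=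
    mul_le_mul_of_nonneg_right (abs_le.1 h2).2 (sq_nonneg _)
  have h5 : 0 ≤ ‖w‖ ^ 2 * (‖z‖ - ‖w‖) ^ 2 := by positivity
  calc ‖z + w‖ ^ 4 = (‖z + w‖ ^ 2) ^ 2 := by ring
    _ ≤ _ := by rw [h1]; nlinarith

/-- The one dimensional case of the hypercontractive inequality. -/
theorem hypercontractive_one {α : Type*} [Fintype α] [DecidableEq α] [Zero α]
    (p : α → ℝ) (hp : ∀ x, 0 ≤ p x) (hp1 : ∑ x, p x = 1)
    (d : α → α → ℂ) (hd0 : ∀ x, d 0 x = 1) (hd : ∀ j, j ≠ 0 → ∑ x, (p x : ℂ) * d j x = 0)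
    (b : ℝ) (hdb : ∀ j, j ≠ 0 → ∀ x, ‖d j x‖ ≤ b)
    (hb : 4 * (b ^ 2 * Fintype.card α) ≤ 1) (z : α → ℂ) :
    ∑ x, p x * ‖∑ j, z j * d j x‖ ^ 4 ≤ (∑ j, ‖z j‖ ^ 2) ^ 2 := by
  set G : α → ℂ := fun x => ∑ j ∈ Finset.univ.erase 0, z j * d j x with hG
  set S : ℝ := ∑ j ∈ Finset.univ.erase 0, ‖z j‖ ^ 2 with hS
  have hS0 : 0 ≤ S := Finset.sum_nonneg fun _ _ => sq_nonneg _
  set τ : ℝ := b ^ 2 * Fintype.card α with hτ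
  have hτ0 : 0 ≤ τ := by positivity
  have hsplit : ∀ x, ∑ j, z j * d j x = z 0 + G x := fun x => by
    rw [← Finset.add_sum_erase _ _ (Finset.mem_univ (0 : α)), hd0, mul_one]
  have hsplit' : ∑ j, ‖z j‖ ^ 2 = ‖z 0‖ ^ 2 + S := by
    rw [← Finset.add_sum_erase _ _ (Finset.mem_univ (0 : α))]
  have hGb : ∀ x, ‖G x‖ ^ 2 ≤ τ * S := fun x => by
    have h1 : ‖G x‖ ≤ ∑ j ∈ Finset.univ.erase 0, b * ‖z j‖ := by
      refine (norm_sum_le _ _).trans (Finset.sum_le_sum fun j hj => ?_)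
      rw [norm_mul, mul_comm]
      exact mul_le_mul_of_nonneg_right (hdb j (Finset.ne_of_mem_erase hj) x) (norm_nonneg _)
    calc ‖G x‖ ^ 2 ≤ (∑ j ∈ Finset.univ.erase 0, b * ‖z j‖) ^ 2 :=
          pow_le_pow_left₀ (norm_nonneg _) h1 2
      _ ≤ ((Finset.univ.erase (0 : α)).card : ℝ) *
            ∑ j ∈ Finset.univ.erase 0, (b * ‖z j‖) ^ 2 := sq_sum_le_card_mul_sum_sq
      _ ≤ (Fintype.card α : ℝ) * ∑ j ∈ Finset.univ.erase 0, (b * ‖z j‖) ^ 2 := by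
          refine mul_le_mul_of_nonneg_right ?_ (Finset.sum_nonneg fun _ _ => sq_nonneg _)
          exact_mod_cast Finset.card_le_univ _
      _ = τ * S := by
          simp_rw [mul_pow, ← Finset.mul_sum, hτ, hS]; ring
  have hmean : ∑ x, p x * (z 0 * (starRingEnd ℂ) (G x)).re = 0 := by
    have h1 : ∑ x, (p x : ℂ) * G x = 0 := by
      simp_rw [hG, Finset.mul_sum]
      rw [Finset.sum_comm]
      refine Finset.sum_eq_zero fun j hj => ?_
      have := hd j (Finset.ne_of_mem_erase hj)
      calc ∑ x, (p x : ℂ) * (z j * d j x) = z j * ∑ x, (p x : ℂ) * d j x := by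
            rw [Finset.mul_sum]; exact Finset.sum_congr rfl fun _ _ => by ring
        _ = 0 := by rw [this, mul_zero]
    have h2 : (z 0 * (starRingEnd ℂ) (∑ x, (p x : ℂ) * G x)).re = 0 := by simp [h1]
    rw [← h2, map_sum, Finset.mul_sum, Complex.re_sum]
    refine Finset.sum_congr rfl fun x _ => ?_
    rw [map_mul, Complex.conj_ofReal, mul_left_comm, Complex.re_ofReal_mul]
  calc ∑ x, p x * ‖∑ j, z j * d j x‖ ^ 4
      ≤ ∑ x, (p x * (‖z 0‖ ^ 4 + 8 * ‖z 0‖ ^ 2 * (τ * S) + 3 * (τ * S) ^ 2)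
          + 4 * ‖z 0‖ ^ 2 * (p x * (z 0 * (starRingEnd ℂ) (G x)).re)) := by
        refine Finset.sum_le_sum fun x _ => ?_
        rw [hsplit x]
        have h1 := norm_add_pow_four_le (z 0) (G x)
        have h2 : ‖z 0‖ ^ 2 * ‖G x‖ ^ 2 ≤ ‖z 0‖ ^ 2 * (τ * S) :=
          mul_le_mul_of_nonneg_left (hGb x) (sq_nonneg _)
        have h3 : (‖G x‖ ^ 2) ^ 2 ≤ (τ * S) ^ 2 := pow_le_pow_left₀ (sq_nonneg _) (hGb x) 2
        have h4 : ‖z 0 + G x‖ ^ 4 ≤ ‖z 0‖ ^ 4 + 8 * ‖z 0‖ ^ 2 * (τ * S) + 3 * (τ * S) ^ 2 +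
            4 * ‖z 0‖ ^ 2 * (z 0 * (starRingEnd ℂ) (G x)).re := by linarith
        exact (mul_le_mul_of_nonneg_left h4 (hp x)).trans_eq (by ring)
    _ = ‖z 0‖ ^ 4 + 8 * ‖z 0‖ ^ 2 * (τ * S) + 3 * (τ * S) ^ 2 := by
        rw [Finset.sum_add_distrib, ← Finset.sum_mul, ← Finset.mul_sum, hmean, hp1]; ring
    -- Since `τ ≤ 1/4`, the middle term is at most `2‖z 0‖² S`, the cross term of `(‖z 0‖² + S)²`;
    -- this is the source of the factor 4 in `hb`.
    _ ≤ (∑ j, ‖z j‖ ^ 2) ^ 2 := by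
        rw [hsplit']
        have h1 : τ * S ≤ S / 4 := by nlinarith
        have h2 : ‖z 0‖ ^ 2 * (τ * S) ≤ ‖z 0‖ ^ 2 * (S / 4) :=
          mul_le_mul_of_nonneg_left h1 (sq_nonneg _)
        have h3 : (τ * S) ^ 2 ≤ (S / 4) ^ 2 := pow_le_pow_left₀ (by positivity) h1 2
        nlinarith [sq_nonneg S]

theorem sum_fin_succ_arrow {α : Type*} [Fintype α] {β : Type*} [AddCommMonoid β] {n : ℕ}
    (f : (Fin (n + 1) → α) → β) :
    ∑ x, f x = ∑ x : Fin n → α, ∑ a, f (Fin.cons a x) := by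
  rw [← (Fin.consEquiv fun _ => α).sum_comp, Fintype.sum_prod_type, Finset.sum_comm]
  rfl

/-- The `L² → L⁴` hypercontractive inequality for product systems of functions. -/
theorem hypercontractive {α : Type*} [Fintype α] [DecidableEq α] [Zero α]
    (p : α → ℝ) (hp : ∀ x, 0 ≤ p x) (hp1 : ∑ x, p x = 1)
    (d : α → α → ℂ) (hd0 : ∀ x, d 0 x = 1) (hd : ∀ j, j ≠ 0 → ∑ x, (p x : ℂ) * d j x = 0)
    (b : ℝ) (hdb : ∀ j, j ≠ 0 → ∀ x, ‖d j x‖ ≤ b)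
    (hb : 4 * (b ^ 2 * Fintype.card α) ≤ 1) (n : ℕ) (a : (Fin n → α) → ℂ) :
    ∑ x : Fin n → α, (∏ i, p (x i)) * ‖∑ y, a y * ∏ i, d (y i) (x i)‖ ^ 4
      ≤ (∑ y, ‖a y‖ ^ 2) ^ 2 := by
  induction n with
  | zero => simp [← pow_mul]
  | succ n ih =>
    set F : α → (Fin n → α) → ℂ := fun j x => ∑ y, a (Fin.cons j y) * ∏ i, d (y i) (x i) with hF
    have hP : ∀ x : Fin n → α, 0 ≤ ∏ i, p (x i) := fun x => Finset.prod_nonneg fun i _ => hp _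
    calc ∑ x : Fin (n + 1) → α, (∏ i, p (x i)) * ‖∑ y, a y * ∏ i, d (y i) (x i)‖ ^ 4
        = ∑ x : Fin n → α, (∏ i, p (x i)) * ∑ s, p s * ‖∑ j, F j x * d j s‖ ^ 4 := by
          rw [sum_fin_succ_arrow]
          refine Finset.sum_congr rfl fun x _ => ?_
          rw [Finset.mul_sum]
          refine Finset.sum_congr rfl fun s _ => ?_
          rw [Fin.prod_univ_succ, sum_fin_succ_arrow, Finset.sum_comm]
          simp only [Fin.cons_zero, Fin.cons_succ, Fin.prod_univ_succ, hF, Finset.sum_mul]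
          rw [mul_comm (p s), mul_assoc]
          congr 4
          exact Finset.sum_congr rfl fun j _ => Finset.sum_congr rfl fun y _ => by ring
      _ ≤ ∑ x : Fin n → α, (∏ i, p (x i)) * (∑ j, ‖F j x‖ ^ 2) ^ 2 :=
          Finset.sum_le_sum fun x _ => mul_le_mul_of_nonneg_left
            (hypercontractive_one p hp hp1 d hd0 hd b hdb hb _) (hP x)
      -- Minkowski in `L²` for the functions `‖F j‖²`, whose `L²` norms are `L⁴` norms squared and
      -- so are bounded by induction.
      _ ≤ (∑ j, ∑ y, ‖a (Fin.cons j y)‖ ^ 2) ^ 2 := by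
          refine sum_sq_sum_le _ hP _ _ (fun j => Finset.sum_nonneg fun _ _ => sq_nonneg _)
            fun j => ?_
          simp only [← pow_mul]
          exact ih fun y => a (Fin.cons j y)
      _ = (∑ y, ‖a y‖ ^ 2) ^ 2 := by rw [sum_fin_succ_arrow, Finset.sum_comm]

theorem prod_ite_eq_pow_hammingNorm {α : Type*} [DecidableEq α] [Zero α] {n : ℕ}
    (ρ : ℂ) (y : Fin n → α) :
    ∏ i, (if y i = 0 then 1 else ρ) = ρ ^ hammingNorm y := by
  rw [Finset.prod_ite, Finset.prod_const_one, one_mul, Finset.prod_const]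
  rfl

/-- The hypercontractive inequality for the noise operator with parameter `ρ`. -/
theorem hypercontractive_noise {α : Type*} [Fintype α] [DecidableEq α] [Zero α]
    (p : α → ℝ) (hp : ∀ x, 0 ≤ p x) (hp1 : ∑ x, p x = 1)
    (c : α → α → ℂ) (hc0 : ∀ x, c 0 x = 1) (hc : ∀ j, j ≠ 0 → ∑ x, (p x : ℂ) * c j x = 0)
    (B : ℝ) (hcB : ∀ j x, ‖c j x‖ ≤ B) (ρ : ℝ) (hρ : 0 ≤ ρ)
    (hB : 4 * ((ρ * B) ^ 2 * Fintype.card α) ≤ 1) (n : ℕ) (a : (Fin n → α) → ℂ) :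
    ∑ x : Fin n → α, (∏ i, p (x i)) *
        ‖∑ y, a y * ((ρ : ℂ) ^ hammingNorm y * ∏ i, c (y i) (x i))‖ ^ 4
      ≤ (∑ y, ‖a y‖ ^ 2) ^ 2 := by
  have h := hypercontractive p hp hp1 (fun j x => (if j = 0 then 1 else (ρ : ℂ)) * c j x)
    (fun x => by simp [hc0])
    (fun j hj => by
      simp only [hj, if_false, mul_left_comm _ (ρ : ℂ), ← Finset.mul_sum, hc j hj, mul_zero])
    (ρ * B)
    (fun j hj x => by
      simp only [hj, if_false, norm_mul, Complex.norm_real, Real.norm_of_nonneg hρ]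
      exact mul_le_mul_of_nonneg_left (hcB j x) hρ) hB n a
  simpa only [Finset.prod_mul_distrib, prod_ite_eq_pow_hammingNorm] using h


/-! ### Orthonormal systems, Bessel and duality -/

section Orthonormal

variable {X Y : Type*} [Fintype X] [Fintype Y] (P : X → ℝ) (v : Y → X → ℂ)

theorem sum_mul_norm_sq_of_orthonormal [DecidableEq Y]
    (hv : ∀ y y', ∑ x, (P x : ℂ) * (v y x * (starRingEnd ℂ) (v y' x)) = if y = y' then 1 else 0)
    (a : Y → ℂ) : ∑ x, P x * ‖∑ y, a y * v y x‖ ^ 2 = ∑ y, ‖a y‖ ^ 2 := by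
  have h : ∑ x, (P x : ℂ) * ((∑ y, a y * v y x) * (starRingEnd ℂ) (∑ y, a y * v y x))
      = ∑ y, a y * (starRingEnd ℂ) (a y) := by
    calc _ = ∑ y, ∑ y', a y * (starRingEnd ℂ) (a y') *
          ∑ x, (P x : ℂ) * (v y x * (starRingEnd ℂ) (v y' x)) := by
          simp_rw [map_sum, Finset.sum_mul_sum, Finset.mul_sum]
          rw [Finset.sum_comm]
          refine Finset.sum_congr rfl fun y _ => ?_
          rw [Finset.sum_comm]
          refine Finset.sum_congr rfl fun y' _ => Finset.sum_congr rfl fun x _ => ?_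
          rw [map_mul]; ring
      _ = _ := by simp [hv]
  simp only [Complex.mul_conj'] at h
  exact_mod_cast h

/-- Pairs `g` with its own multiplier transform; neither orthogonality nor completeness of `v` is
needed. -/
theorem sum_mul_norm_sq_coeff (g : X → ℂ) (r : Y → ℝ) :
    ((∑ y, r y * ‖∑ x, (P x : ℂ) * (g x * (starRingEnd ℂ) (v y x))‖ ^ 2 : ℝ) : ℂ) =
      ∑ x, (P x : ℂ) * (g x * (starRingEnd ℂ)
        (∑ y, (r y : ℂ) * (∑ x, (P x : ℂ) * (g x * (starRingEnd ℂ) (v y x))) * v y x)) := by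
  set a : Y → ℂ := fun y => ∑ x, (P x : ℂ) * (g x * (starRingEnd ℂ) (v y x)) with ha
  have h1 : ∀ x, (P x : ℂ) * (g x * (starRingEnd ℂ) (∑ y, (r y : ℂ) * a y * v y x)) =
      ∑ y, (r y : ℂ) * (starRingEnd ℂ) (a y) * ((P x : ℂ) * (g x * (starRingEnd ℂ) (v y x))) := by
    intro x
    simp only [map_sum, map_mul, Complex.conj_ofReal, Finset.mul_sum]
    exact Finset.sum_congr rfl fun y _ => by ring
  rw [Finset.sum_congr rfl fun x _ => h1 x, Finset.sum_comm]
  push_cast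
  refine Finset.sum_congr rfl fun y _ => ?_
  rw [← Finset.mul_sum, mul_assoc, mul_comm ((starRingEnd ℂ) (a y)), ← Complex.mul_conj']

theorem sum_mul_norm_sq_coeff_le (hP : ∀ x, 0 ≤ P x) (g : X → ℂ) (r : Y → ℝ) :
    ∑ y, r y * ‖∑ x, (P x : ℂ) * (g x * (starRingEnd ℂ) (v y x))‖ ^ 2 ≤
      ∑ x, P x * (‖g x‖ * ‖∑ y, (r y : ℂ) *
        (∑ x, (P x : ℂ) * (g x * (starRingEnd ℂ) (v y x))) * v y x‖) := by
  have h := congrArg norm (sum_mul_norm_sq_coeff P v g r)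
  rw [Complex.norm_real] at h
  refine (le_abs_self _).trans (h.le.trans ((norm_sum_le _ _).trans (le_of_eq ?_)))
  refine Finset.sum_congr rfl fun x _ => ?_
  rw [norm_mul, norm_mul, RCLike.norm_conj, Complex.norm_real, Real.norm_of_nonneg (hP x)]

/-- Bessel's inequality. -/
theorem sum_norm_sq_coeff_le [DecidableEq Y] (hP : ∀ x, 0 ≤ P x)
    (hv : ∀ y y', ∑ x, (P x : ℂ) * (v y x * (starRingEnd ℂ) (v y' x)) = if y = y' then 1 else 0)
    (g : X → ℂ) :
    ∑ y, ‖∑ x, (P x : ℂ) * (g x * (starRingEnd ℂ) (v y x))‖ ^ 2 ≤ ∑ x, P x * ‖g x‖ ^ 2 := by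
  have h1 := sum_mul_norm_sq_coeff_le P v hP g fun _ => 1
  simp only [one_mul, Complex.ofReal_one] at h1
  set a : Y → ℂ := fun y => ∑ x, (P x : ℂ) * (g x * (starRingEnd ℂ) (v y x)) with ha
  have h2 := sq_sum_mul_le Finset.univ P (fun x => ‖g x‖) (fun x => ‖∑ y, a y * v y x‖)
    fun x _ => hP x
  rw [sum_mul_norm_sq_of_orthonormal P v hv] at h2
  have hQ : 0 ≤ ∑ y, ‖a y‖ ^ 2 := Finset.sum_nonneg fun _ _ => sq_nonneg _
  have hG : 0 ≤ ∑ x, P x * ‖g x‖ ^ 2 :=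
    Finset.sum_nonneg fun x _ => mul_nonneg (hP x) (sq_nonneg _)
  have h3 : (∑ y, ‖a y‖ ^ 2) ^ 2 ≤ (∑ x, P x * ‖g x‖ ^ 2) * ∑ y, ‖a y‖ ^ 2 :=
    (pow_le_pow_left₀ hQ h1 2).trans h2
  rcases hQ.eq_or_lt with h0 | h0
  · exact h0.symm.le.trans hG
  · rw [sq] at h3
    exact le_of_mul_le_mul_right h3 h0

/-- The dual form of an `L² → L⁴` inequality, interpolated between `L¹` and `L²`. -/
theorem sum_sq_mul_norm_sq_coeff_le (hP : ∀ x, 0 ≤ P x) (g : X → ℂ) (r : Y → ℝ)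
    (hr : ∀ a : Y → ℂ, ∑ x, P x * ‖∑ y, a y * ((r y : ℂ) * v y x)‖ ^ 4 ≤ (∑ y, ‖a y‖ ^ 2) ^ 2) :
    ∑ y, r y ^ 2 * ‖∑ x, (P x : ℂ) * (g x * (starRingEnd ℂ) (v y x))‖ ^ 2 ≤
      (∑ x, P x * ‖g x‖) * √(∑ x, P x * ‖g x‖ ^ 2) := by
  have h1 := sum_mul_norm_sq_coeff_le P v hP g fun y => r y ^ 2
  set a : Y → ℂ := fun y => ∑ x, (P x : ℂ) * (g x * (starRingEnd ℂ) (v y x)) with ha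
  set h : X → ℝ := fun x => ‖∑ y, ((r y ^ 2 : ℝ) : ℂ) * a y * v y x‖ with hh
  set Q : ℝ := ∑ y, r y ^ 2 * ‖a y‖ ^ 2 with hQdef
  set N1 : ℝ := ∑ x, P x * ‖g x‖
  set S : ℝ := ∑ x, P x * ‖g x‖ ^ 2
  have hQ : 0 ≤ Q := Finset.sum_nonneg fun _ _ => by positivity
  have hN1 : 0 ≤ N1 := Finset.sum_nonneg fun x _ => mul_nonneg (hP x) (norm_nonneg _)
  have hS : 0 ≤ S := Finset.sum_nonneg fun x _ => mul_nonneg (hP x) (sq_nonneg _)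
  have h4 : ∑ x, P x * h x ^ 4 ≤ Q ^ 2 := by
    have := hr fun y => (r y : ℂ) * a y
    simp only [norm_mul, Complex.norm_real, Real.norm_eq_abs, mul_pow, sq_abs] at this
    refine le_of_eq_of_le (Finset.sum_congr rfl fun x _ => ?_) this
    simp only [hh]
    congr 3
    exact Finset.sum_congr rfl fun y _ => by push_cast; ring
  -- Cauchy-Schwarz with weight `P‖g‖` extracts the `L¹` norm; a second one in `h3` extracts the
  -- `L²` norm. Together they replace Hölder with exponents 4/3 and 4.
  have h2 : (∑ x, P x * (‖g x‖ * h x)) ^ 2 ≤ N1 * ∑ x, P x * (‖g x‖ * h x ^ 2) := by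
    have := sq_sum_mul_le Finset.univ (fun x => P x * ‖g x‖) (fun _ => 1) h
      fun x _ => mul_nonneg (hP x) (norm_nonneg _)
    simpa only [one_pow, one_mul, mul_one, mul_assoc] using this
  have h3 : ∑ x, P x * (‖g x‖ * h x ^ 2) ≤ √S * Q := by
    refine (abs_le_of_sq_le_sq' ?_ (by positivity)).2
    refine (sq_sum_mul_le Finset.univ P (fun x => ‖g x‖) (fun x => h x ^ 2)
      fun x _ => hP x).trans ?_
    rw [mul_pow, Real.sq_sqrt hS]
    simp only [← pow_mul]
    exact mul_le_mul_of_nonneg_left h4 hS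
  have h5 : Q ^ 2 ≤ N1 * √S * Q := by
    rw [mul_assoc]
    exact (pow_le_pow_left₀ hQ h1 2).trans (h2.trans (mul_le_mul_of_nonneg_left h3 hN1))
  rcases hQ.eq_or_lt with h0 | h0
  · exact h0.symm.le.trans (by positivity)
  · rw [sq] at h5
    exact le_of_mul_le_mul_right h5 h0

end Orthonormal

/-- The cut-off `N = ⌊L / (4d)⌋` makes `2Nd ≤ L/2`, so the first term still decays like `exp(-L/2)`,
while `1 + L ≤ 5d(N + 1)` handles the second. -/
theorem exp_mul_exp_neg_add_inv_le {L d : ℝ} (hL : 0 ≤ L) (hd : 1 ≤ d) :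
    Real.exp (2 * ⌊L / (4 * d)⌋₊ * d) * Real.exp (-L) + 1 / ((⌊L / (4 * d)⌋₊ : ℝ) + 1)
      ≤ 7 * d / (1 + L) := by
  have hd0 : 0 < d := by linarith
  have h1 : (⌊L / (4 * d)⌋₊ : ℝ) ≤ L / (4 * d) := Nat.floor_le (by positivity)
  have h2 : L / (4 * d) < (⌊L / (4 * d)⌋₊ : ℝ) + 1 := Nat.lt_floor_add_one _
  set N : ℝ := (⌊L / (4 * d)⌋₊ : ℝ)
  have hN : 0 ≤ N := Nat.cast_nonneg _
  rw [le_div_iff₀ (by positivity)] at h1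
  rw [div_lt_iff₀ (by positivity)] at h2
  have h3 : Real.exp (2 * N * d) * Real.exp (-L) ≤ 2 / (1 + L) := by
    rw [← Real.exp_add]
    calc Real.exp (2 * N * d + -L) ≤ Real.exp (-(L / 2)) := Real.exp_le_exp.2 (by linarith)
      _ = (Real.exp (L / 2))⁻¹ := Real.exp_neg _
      _ ≤ (L / 2 + 1)⁻¹ := inv_anti₀ (by positivity) (Real.add_one_le_exp _)
      _ ≤ 2 / (1 + L) := by
        rw [inv_eq_one_div, div_le_div_iff₀ (by positivity) (by positivity)]; linarith
  have h4 : 1 / (N + 1) ≤ 5 * d / (1 + L) := by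
    rw [div_le_div_iff₀ (by positivity) (by positivity)]
    nlinarith
  calc _ ≤ 2 / (1 + L) + 5 * d / (1 + L) := add_le_add h3 h4
    _ = (2 + 5 * d) / (1 + L) := by rw [add_div]
    _ ≤ 7 * d / (1 + L) := by gcongr; linarith

/-- The low/high degree split: for `m ≤ N` the first term alone suffices, for `m ≥ N + 1` the
second. -/
theorem div_le_pow_mul_add_div {D w : ℝ} (hD : 1 ≤ D) (hw : 0 ≤ w) {m : ℕ} (hm : m ≠ 0) (N : ℕ) :
    w / m ≤ D ^ (2 * N) * ((D⁻¹ ^ m) ^ 2 * w) + 1 / ((N : ℝ) + 1) * w := by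
  have hD0 : 0 < D := by linarith
  rcases le_or_gt m N with h | h
  · have h1 : w / m ≤ w := div_le_self hw (by exact_mod_cast Nat.one_le_iff_ne_zero.2 hm)
    have h2 : 1 ≤ D ^ (2 * N) * (D⁻¹ ^ m) ^ 2 := by
      rw [← pow_mul, inv_pow, ← div_eq_mul_inv, one_le_div (by positivity)]
      exact pow_le_pow_right₀ hD (by omega)
    have h3 : 0 ≤ 1 / ((N : ℝ) + 1) * w := by positivity
    nlinarith [mul_le_mul_of_nonneg_right h2 hw]
  · have h1 : w / m ≤ 1 / ((N : ℝ) + 1) * w := by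
      rw [one_div_mul_eq_div]
      exact div_le_div_of_nonneg_left hw (by positivity) (by exact_mod_cast h)
    have : 0 ≤ D ^ (2 * N) * ((D⁻¹ ^ m) ^ 2 * w) := by positivity
    linarith

/-! ### Product measures and the bound by `log θ` -/

section Measure

variable {k : ℕ} [NeZero k] {n : ℕ}

theorem integral_powMeasure {E : Type*} [NormedAddCommGroup E] [NormedSpace ℝ E] [CompleteSpace E]
    (μ : Measure (ZMod k)) [IsProbabilityMeasure μ] (f : (Fin n → ZMod k) → E) :
    ∫ x, f x ∂(powMeasure μ n) = ∑ x, (∏ i, μ.real {x i}) • f x := by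
  rw [integral_fintype .of_finite]
  refine Finset.sum_congr rfl fun x _ => ?_
  rw [measureReal_def, Measure.pi_singleton, ENNReal.toReal_prod]
  rfl

theorem integral_uniformOn {X E : Type*} [Fintype X] [Nonempty X] [MeasurableSpace X]
    [MeasurableSingletonClass X] [NormedAddCommGroup E] [NormedSpace ℝ E] [CompleteSpace E]
    (f : X → E) :
    ∫ x, f x ∂(ProbabilityTheory.uniformOn (Set.univ : Set X)) =
      ∑ x, (Fintype.card X : ℝ)⁻¹ • f x := by
  rw [integral_fintype .of_finite]
  refine Finset.sum_congr rfl fun x _ => ?_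
  rw [measureReal_def, ProbabilityTheory.uniformOn_univ]
  simp

theorem ip_eq_sum (μ : Measure (ZMod k)) [IsProbabilityMeasure μ] (f g : ZMod k → ℂ) :
    ip μ f g = ∑ x, ((μ.real {x} : ℝ) : ℂ) * (f x * (starRingEnd ℂ) (g x)) := by
  rw [ip, integral_fintype .of_finite]
  simp

theorem coeff_eq_sum (μ : Measure (ZMod k)) [IsProbabilityMeasure μ] (c : ZMod k → ZMod k → ℂ)
    (g : (Fin n → ZMod k) → ℂ) (y : Fin n → ZMod k) :
    coeff μ c g y = ∑ x, ((∏ i, μ.real {x i} : ℝ) : ℂ) * (g x * (starRingEnd ℂ) (u c y x)) := by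
  rw [coeff, ip, integral_powMeasure]
  simp

theorem orthonormal_u {μ : Measure (ZMod k)} [IsProbabilityMeasure μ] {c : ZMod k → ZMod k → ℂ}
    (hc : IsAdaptedBasis μ c) (y y' : Fin n → ZMod k) :
    ∑ x, ((∏ i, μ.real {x i} : ℝ) : ℂ) * (u c y x * (starRingEnd ℂ) (u c y' x)) =
      if y = y' then 1 else 0 := by
  calc _ = ∑ x : Fin n → ZMod k, ∏ i, ((μ.real {x i} : ℝ) : ℂ) *
        (c (y i) (x i) * (starRingEnd ℂ) (c (y' i) (x i))) := by
        refine Finset.sum_congr rfl fun x _ => ?_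
        simp only [u, map_prod, Finset.prod_mul_distrib, Complex.ofReal_prod]
    _ = ∏ i, ip μ (c (y i)) (c (y' i)) := by
        simp_rw [ip_eq_sum]
        rw [Finset.prod_univ_sum, Fintype.piFinset_univ]
    _ = ∏ i, if y i = y' i then 1 else 0 := by simp_rw [hc.2]
    _ = _ := by
        rw [Finset.prod_ite_zero]
        simp [funext_iff]

theorem sum_measureReal_singleton (μ : Measure (ZMod k)) [IsProbabilityMeasure μ] :
    ∑ x, μ.real {x} = 1 := by
  simp

theorem sum_mul_eq_zero {μ : Measure (ZMod k)} [IsProbabilityMeasure μ] {c : ZMod k → ZMod k → ℂ}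
    (hc : IsAdaptedBasis μ c) {j : ZMod k} (hj : j ≠ 0) :
    ∑ x, ((μ.real {x} : ℝ) : ℂ) * c j x = 0 := by
  have := hc.2 j 0
  rw [ip_eq_sum, if_neg hj] at this
  simpa [hc.1] using this

theorem norm_le_theta_div (c : ZMod k → ZMod k → ℂ) (i j : ZMod k) : ‖c i j‖ ≤ theta c / k := by
  have hk : (0 : ℝ) < k := Nat.cast_pos.2 (NeZero.pos k)
  rw [theta, mul_div_cancel_left₀ _ hk.ne']
  exact le_ciSup (f := fun p : ZMod k × ZMod k => ‖c p.1 p.2‖) (Set.finite_range _).bddAbove (i, j)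

theorem le_theta {μ : Measure (ZMod k)} {c : ZMod k → ZMod k → ℂ} (hc : IsAdaptedBasis μ c) :
    (k : ℝ) ≤ theta c := by
  have hk : (0 : ℝ) < k := Nat.cast_pos.2 (NeZero.pos k)
  have := norm_le_theta_div c 0 0
  rwa [hc.1, norm_one, one_le_div hk] at this

theorem lqNorm_one (μ : Measure (ZMod k)) [IsProbabilityMeasure μ] (g : (Fin n → ZMod k) → ℂ) :
    lqNorm (powMeasure μ n) 1 g = ∑ x, (∏ i, μ.real {x i}) * ‖g x‖ := by
  simp [lqNorm, integral_powMeasure]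

theorem lqNorm_two (μ : Measure (ZMod k)) [IsProbabilityMeasure μ] (g : (Fin n → ZMod k) → ℂ) :
    lqNorm (powMeasure μ n) 2 g = √(∑ x, (∏ i, μ.real {x i}) * ‖g x‖ ^ 2) := by
  simp [lqNorm, integral_powMeasure, Real.sqrt_eq_rpow]

theorem M_sq (μ : Measure (ZMod k)) (c : ZMod k → ZMod k → ℂ) (g : (Fin n → ZMod k) → ℂ) :
    M μ c g ^ 2 = ∑ y with y ≠ 0, ‖coeff μ c g y‖ ^ 2 / (hammingNorm y : ℝ) := by
  rw [M, Real.sq_sqrt]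
  exact Finset.sum_nonneg fun y _ => by positivity

theorem M_sq_le {μ : Measure (ZMod k)} [IsProbabilityMeasure μ] {c : ZMod k → ZMod k → ℂ}
    (hc : IsAdaptedBasis μ c) (hk : 2 ≤ k) (g : (Fin n → ZMod k) → ℂ) (N : ℕ) :
    M μ c g ^ 2 ≤ (theta c ^ 2) ^ (2 * N) *
        (lqNorm (powMeasure μ n) 1 g * lqNorm (powMeasure μ n) 2 g)
      + 1 / ((N : ℝ) + 1) * lqNorm (powMeasure μ n) 2 g ^ 2 := by
  have hkθ := le_theta hc
  have hk2 : (2 : ℝ) ≤ k := by exact_mod_cast hk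
  have hθ : 2 ≤ theta c := hk2.trans hkθ
  have hP : ∀ x : Fin n → ZMod k, 0 ≤ ∏ i, μ.real {x i} :=
    fun x => Finset.prod_nonneg fun _ _ => measureReal_nonneg
  have hbessel := sum_norm_sq_coeff_le _ (u c) hP (orthonormal_u hc) g
  -- With `ρ = θ⁻²` the scaled basis is bounded by `1 / (θk)`, and the smallness condition becomes
  -- `4 / (θ² k) ≤ 1`.
  have hdual := sum_sq_mul_norm_sq_coeff_le _ (u c) hP g
    (fun y => ((theta c ^ 2)⁻¹) ^ hammingNorm y) fun a => by
      have := hypercontractive_noise (fun x => μ.real {x}) (fun _ => measureReal_nonneg)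
        (sum_measureReal_singleton μ) c hc.1 (fun j hj => sum_mul_eq_zero hc hj)
        (theta c / k) (norm_le_theta_div c) ((theta c ^ 2)⁻¹) (by positivity) (by
          rw [ZMod.card]
          have : 4 * (((theta c ^ 2)⁻¹ * (theta c / k)) ^ 2 * k) = 4 / (theta c ^ 2 * k) := by
            field_simp
          rw [this, div_le_one (by positivity)]
          nlinarith) n a
      simpa only [Complex.ofReal_pow, u] using this
  simp only [← coeff_eq_sum] at hbessel hdual
  rw [← lqNorm_one, ← lqNorm_two] at hdual
  rw [M_sq]
  have hS : lqNorm (powMeasure μ n) 2 g ^ 2 = ∑ x, (∏ i, μ.real {x i}) * ‖g x‖ ^ 2 := by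
    rw [lqNorm_two, Real.sq_sqrt]
    exact Finset.sum_nonneg fun x _ => mul_nonneg (hP x) (sq_nonneg _)
  calc ∑ y with y ≠ 0, ‖coeff μ c g y‖ ^ 2 / (hammingNorm y : ℝ)
      ≤ ∑ y with y ≠ 0, ((theta c ^ 2) ^ (2 * N) *
          (((theta c ^ 2)⁻¹ ^ hammingNorm y) ^ 2 * ‖coeff μ c g y‖ ^ 2)
          + 1 / ((N : ℝ) + 1) * ‖coeff μ c g y‖ ^ 2) := by
        refine Finset.sum_le_sum fun y hy => ?_
        refine div_le_pow_mul_add_div (by nlinarith) (sq_nonneg _) ?_ N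
        exact hammingNorm_ne_zero_iff.2 (Finset.mem_filter.1 hy).2
    _ ≤ ∑ y, ((theta c ^ 2) ^ (2 * N) *
          (((theta c ^ 2)⁻¹ ^ hammingNorm y) ^ 2 * ‖coeff μ c g y‖ ^ 2)
          + 1 / ((N : ℝ) + 1) * ‖coeff μ c g y‖ ^ 2) :=
        Finset.sum_le_sum_of_subset_of_nonneg (Finset.filter_subset _ _)
          fun y _ _ => by positivity
    _ ≤ _ := by
        rw [Finset.sum_add_distrib, ← Finset.mul_sum, ← Finset.mul_sum, hS]
        gcongr

theorem lqNorm_one_le_lqNorm_two (μ : Measure (ZMod k)) [IsProbabilityMeasure μ]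
    (g : (Fin n → ZMod k) → ℂ) :
    lqNorm (powMeasure μ n) 1 g ≤ lqNorm (powMeasure μ n) 2 g := by
  rw [lqNorm_one, lqNorm_two]
  apply Real.le_sqrt_of_sq_le
  have h := sq_sum_mul_le Finset.univ (fun x : Fin n → ZMod k => ∏ i, μ.real {x i})
    (fun x => ‖g x‖) (fun _ => 1) fun x _ => Finset.prod_nonneg fun _ _ => measureReal_nonneg
  have h1 : ∑ x : Fin n → ZMod k, ∏ i, μ.real {x i} = 1 := by
    have := integral_powMeasure (n := n) μ fun _ => (1 : ℝ)
    simpa using this.symm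
  simpa [h1] using h

theorem lqNorm_one_pos {μ : Measure (ZMod k)} [IsProbabilityMeasure μ] (hμ : ∀ j, 0 < μ {j})
    {g : (Fin n → ZMod k) → ℂ} (hg : g ≠ 0) : 0 < lqNorm (powMeasure μ n) 1 g := by
  obtain ⟨x, hx⟩ := Function.ne_iff.1 hg
  have hp : ∀ j, 0 < μ.real {j} := fun j => ENNReal.toReal_pos (hμ j).ne' (measure_ne_top _ _)
  rw [lqNorm_one]
  exact Finset.sum_pos' (fun x _ => mul_nonneg (Finset.prod_nonneg fun _ _ => (hp _).le)
    (norm_nonneg _)) ⟨x, Finset.mem_univ _, mul_pos (Finset.prod_pos fun _ _ => hp _)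
    (norm_pos_iff.2 hx)⟩

/-- Talagrand's inequality, with a constant that depends on `θ` only. -/
theorem M_sq_le_log_theta {μ : Measure (ZMod k)} [IsProbabilityMeasure μ] (hμ : ∀ j, 0 < μ {j})
    {c : ZMod k → ZMod k → ℂ} (hc : IsAdaptedBasis μ c) (hk : 2 ≤ k)
    {g : (Fin n → ZMod k) → ℂ} (hg : g ≠ 0) :
    M μ c g ^ 2 ≤ 14 * Real.log (theta c) * (lqNorm (powMeasure μ n) 2 g ^ 2 /
      Real.log (Real.exp 1 * lqNorm (powMeasure μ n) 2 g / lqNorm (powMeasure μ n) 1 g)) := by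
  have hθ : 2 ≤ theta c := le_trans (by exact_mod_cast hk) (le_theta hc)
  have h1 := lqNorm_one_pos hμ hg
  have h12 := lqNorm_one_le_lqNorm_two μ g
  have hM := M_sq_le hc hk g
  set N1 := lqNorm (powMeasure μ n) 1 g
  set N2 := lqNorm (powMeasure μ n) 2 g
  have h2 : 0 < N2 := h1.trans_le h12
  set L := Real.log (N2 / N1) with hL
  have hL0 : 0 ≤ L := Real.log_nonneg ((one_le_div h1).2 h12)
  -- Chosen so that `θ² = exp d`; `θ ≥ 2` gives `d ≥ 1` because `2 log 2 > 1`.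
  set d := 2 * Real.log (theta c) with hd
  have hd1 : 1 ≤ d := by
    have := Real.log_le_log (by norm_num) hθ
    have := Real.log_two_gt_d9
    linarith
  have hlog : Real.log (Real.exp 1 * N2 / N1) = 1 + L := by
    rw [mul_div_assoc, Real.log_mul (Real.exp_ne_zero _) (by positivity), Real.log_exp]
  have hpow : ∀ N : ℕ, (theta c ^ 2) ^ (2 * N) = Real.exp (2 * N * d) := fun N => by
    rw [← pow_mul, ← Real.exp_log (by positivity : (0 : ℝ) < theta c), ← Real.exp_nat_mul, hd]
    push_cast; ring_nf
  have hN : N1 * N2 = Real.exp (-L) * N2 ^ 2 := by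
    rw [Real.exp_neg, hL, Real.exp_log (by positivity)]
    field_simp
  calc M μ c g ^ 2 ≤ _ := hM ⌊L / (4 * d)⌋₊
    _ = (Real.exp (2 * ⌊L / (4 * d)⌋₊ * d) * Real.exp (-L) + 1 / ((⌊L / (4 * d)⌋₊ : ℝ) + 1))
          * N2 ^ 2 := by rw [hpow, hN]; ring
    _ ≤ 7 * d / (1 + L) * N2 ^ 2 :=
        mul_le_mul_of_nonneg_right (exp_mul_exp_neg_add_inv_le hL0 hd1) (sq_nonneg _)
    _ = _ := by rw [hlog, hd]; ring

end Measure

/-! ### Admissible pairs -/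

/-- Test on a single character with `n = m = 1`: it has modulus 1, so its `L⁴` norm is 1. A non-zero
frequency exists because `k ≥ 2`. -/
theorem one_le_of_hypercontractiveConstants {C γ : ℝ} (h : HypercontractiveConstants C γ)
    {k : ℕ} [NeZero k] (hk : 2 ≤ k) : 1 ≤ C * (k : ℝ) ^ γ := by
  have : Fact (1 < k) := ⟨hk⟩
  have h1 := h.2.2 k 1 1 le_rfl (Pi.single 1 1)
  have hn : hammingNorm (1 : Fin 1 → ZMod k) = 1 := by simp [hammingNorm]
  have hs : ∀ f : (Fin 1 → ZMod k) → ℂ,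
      ∑ y with hammingNorm y = 1, (Pi.single 1 1 : (Fin 1 → ZMod k) → ℂ) y * f y = f 1 := fun f => by
    rw [Finset.sum_eq_single_of_mem 1 (by simp [hn])]
    · simp
    · intro y _ hy; simp [hy]
  have hs' : ∑ y with hammingNorm y = 1, ‖(Pi.single 1 1 : (Fin 1 → ZMod k) → ℂ) y‖ ^ 2 = 1 := by
    rw [Finset.sum_eq_single_of_mem 1 (by simp [hn])]
    · simp
    · intro y _ hy; simp [hy]
  simp only [hs, hs'] at h1
  simpa [lqNorm, w, AddChar.norm_apply] using h1

theorem w_eq_prod {k : ℕ} [NeZero k] {n : ℕ} (y x : Fin n → ZMod k) :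
    w y x = ∏ i, (ZMod.stdAddChar (x i * y i) : ℂ) := by
  exact map_prod (ZMod.stdAddChar (N := k)).toMonoidHom
    (fun i => Multiplicative.ofAdd (x i * y i)) Finset.univ

/-- The hypercontractive inequality for characters. -/
theorem hypercontractiveConstants_two_half : HypercontractiveConstants 2 (1 / 2) := by
  refine ⟨by norm_num, by norm_num, fun k _ n m _ a => ?_⟩
  have hk : (0 : ℝ) < k := Nat.cast_pos.2 (NeZero.pos k)
  rw [← Real.sqrt_eq_rpow]
  set D : ℝ := 2 * √k with hD
  have hD0 : 0 < D := by positivity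
  have hD2 : D ^ 2 = 4 * k := by rw [hD, mul_pow, Real.sq_sqrt hk.le]; norm_num
  set A : ℝ := ∑ y with hammingNorm y = m, ‖a y‖ ^ 2 with hA
  have hA0 : 0 ≤ A := Finset.sum_nonneg fun _ _ => sq_nonneg _
  have h := hypercontractive_noise (fun _ : ZMod k => (k : ℝ)⁻¹) (fun _ => by positivity)
    (by simp [ZMod.card, hk.ne'])
    (fun j x => (ZMod.stdAddChar (x * j) : ℂ)) (by simp)
    (fun j hj => by
      rw [← Finset.mul_sum, AddChar.sum_mulShift j (ZMod.isPrimitive_stdAddChar k), if_neg hj]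
      simp)
    1 (fun j x => (AddChar.norm_apply _ _).le) D⁻¹ (by positivity)
    (by rw [ZMod.card, mul_one, inv_pow, hD2]; field_simp; rfl) n
    -- The factor `D^m` undoes the noise `ρ^m`; `ρ = D⁻¹ = 1 / (2√k)` gives equality in `4ρ²k ≤ 1`.
    (fun y => if hammingNorm y = m then (D : ℂ) ^ m * a y else 0)
  have h1 : ∀ x : Fin n → ZMod k, ∑ y, (if hammingNorm y = m then (D : ℂ) ^ m * a y else 0) *
      (((D⁻¹ : ℝ) : ℂ) ^ hammingNorm y * ∏ i, (ZMod.stdAddChar (x i * y i) : ℂ)) =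
      ∑ y with hammingNorm y = m, a y * w y x := fun x => by
    rw [Finset.sum_filter]
    refine Finset.sum_congr rfl fun y _ => ?_
    split_ifs with hy
    · rw [w_eq_prod, hy]
      have : (D : ℂ) ≠ 0 := by exact_mod_cast hD0.ne'
      rw [Complex.ofReal_inv, inv_pow]
      field_simp
    · simp
  have h2 : ∑ y, ‖if hammingNorm y = m then (D : ℂ) ^ m * a y else 0‖ ^ 2 = (D ^ m) ^ 2 * A := by
    rw [hA, Finset.sum_filter, Finset.mul_sum]
    refine Finset.sum_congr rfl fun y _ => ?_
    split_ifs with hy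
    · rw [norm_mul, norm_pow, Complex.norm_real, Real.norm_of_nonneg hD0.le, mul_pow]
    · simp
  simp only [h1, h2] at h
  have h3 : lqNorm (ProbabilityTheory.uniformOn (Set.univ : Set (Fin n → ZMod k))) 4
      (fun x => ∑ y with hammingNorm y = m, a y * w y x) =
      (∑ x : Fin n → ZMod k, (∏ _i : Fin n, (k : ℝ)⁻¹) *
        ‖∑ y with hammingNorm y = m, a y * w y x‖ ^ 4) ^ (1 / 4 : ℝ) := by
    rw [lqNorm, integral_uniformOn]
    congr 1
    refine Finset.sum_congr rfl fun x _ => ?_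
    rw [smul_eq_mul, Finset.prod_const, Finset.card_univ, Fintype.card_fin, Fintype.card_fun,
      Fintype.card_fin, ZMod.card, inv_pow]
    congr 1
    · push_cast; rfl
    · exact_mod_cast Real.rpow_natCast _ 4
  rw [h3]
  have h4 : ((D ^ m) ^ 2 * A) ^ 2 = (D ^ m * √A) ^ (4 : ℕ) := by
    rw [mul_pow _ _ 4, mul_pow, show √A ^ 4 = (√A ^ 2) ^ 2 by ring, Real.sq_sqrt hA0]; ring
  calc _ ≤ ((D ^ m * √A) ^ (4 : ℕ)) ^ (1 / 4 : ℝ) :=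
        Real.rpow_le_rpow (Finset.sum_nonneg fun _ _ => by positivity) (h.trans_eq h4)
          (by norm_num)
    _ = D ^ m * √A := by
        rw [one_div]
        exact_mod_cast Real.pow_rpow_inv_natCast (by positivity) (n := 4) (by norm_num)

end TalagrandZk

theorem mainTheorem4 :
    (∃ C γ : ℝ, TalagrandZk.HypercontractiveConstants C γ) ∧
    ∃ K : ℝ, 0 < K ∧
      ∀ C γ : ℝ, TalagrandZk.HypercontractiveConstants C γ →
      ∀ (k : ℕ) [NeZero k] (n : ℕ)
        (μ : Measure (ZMod k)) [IsProbabilityMeasure μ], (∀ j : ZMod k, 0 < μ {j}) →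
      ∀ c : ZMod k → ZMod k → ℂ, TalagrandZk.IsAdaptedBasis μ c →
      ∀ g : (Fin n → ZMod k) → ℂ, ∫ x, g x ∂(TalagrandZk.powMeasure μ n) = 0 →
        TalagrandZk.M μ c g ^ 2 ≤
          K * Real.log (C * TalagrandZk.theta c * (k : ℝ) ^ γ) *
            (TalagrandZk.lqNorm (TalagrandZk.powMeasure μ n) 2 g ^ 2 /
              Real.log (Real.exp 1 * TalagrandZk.lqNorm (TalagrandZk.powMeasure μ n) 2 g /
                TalagrandZk.lqNorm (TalagrandZk.powMeasure μ n) 1 g)) := by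
  refine ⟨⟨2, 1 / 2, TalagrandZk.hypercontractiveConstants_two_half⟩, 14, by norm_num, ?_⟩
  intro C γ hC k _ n μ _ hμ c hc g hg
  by_cases hg0 : g = 0
  · subst hg0
    simp [TalagrandZk.M, TalagrandZk.coeff, TalagrandZk.ip, TalagrandZk.lqNorm]
  -- For `k = 1` the space is a single point, so mean zero forces `g = 0`.
  have hk : 2 ≤ k := by
    by_contra hk
    obtain rfl : k = 1 := by have := NeZero.pos k; omega
    refine hg0 (funext fun x => ?_)
    have hp : ∀ z : ZMod 1, μ.real {z} = 1 := fun z => by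
      rw [Subsingleton.eq_univ_of_nonempty (Set.singleton_nonempty z), probReal_univ]
    rw [TalagrandZk.integral_powMeasure, Fintype.sum_subsingleton _ x] at hg
    simp_rw [hp, Finset.prod_const_one, one_smul] at hg
    exact hg
  refine (TalagrandZk.M_sq_le_log_theta hμ hc hk hg0).trans ?_
  have hθ : 0 < TalagrandZk.theta c :=
    lt_of_lt_of_le (Nat.cast_pos.2 (NeZero.pos k)) (TalagrandZk.le_theta hc)
  have h1 := TalagrandZk.lqNorm_one_pos hμ hg0
  have h12 := TalagrandZk.lqNorm_one_le_lqNorm_two μ g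
  refine mul_le_mul_of_nonneg_right (mul_le_mul_of_nonneg_left ?_ (by norm_num))
    (div_nonneg (sq_nonneg _) (Real.log_nonneg ?_))
  · refine Real.log_le_log hθ ?_
    rw [mul_right_comm]
    exact le_mul_of_one_le_left hθ.le (TalagrandZk.one_le_of_hypercontractiveConstants hC hk)
  · rw [one_le_div h1]
    exact h12.trans (le_mul_of_one_le_left (h1.le.trans h12) (Real.one_le_exp zero_le_one))
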